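/- **Conventions.** Let $d\in\mathbf N$, $\varepsilon_0>0$, $\varepsilon\in\,]0,\varepsilon_0]$. A quantity $g_\varepsilon\ge 0$ is $O(\varepsilon^\infty)$ if for every $M\in\mathbf N$ there are $\varepsilon_1>0$ and $C$ with $g_\varepsilon\le C\varepsilon^M$ for all $\varepsilon\in\,]0,\varepsilon_1]$. For a symbol $a$ on $\mathbf R^{2d}$, $$\mathrm{Op}^W_\varepsilon(a)u(x)=\frac1{(2\pi\varepsilon)^d}\int\!\!\int e^{i(x-y)\cdot\xi/\varepsilon}\,a\Big(\frac{x+y}2,\xi\Big)u(y)\,dy\,d\xi ,$$ extended from Schwartz functions to $L^2(\mathbf R^d)$ in the sense of tempered distributions. A family of pseudodifferential operators $A_\varepsilon$ is a family of (possibly unbounded) linear operators in $L^2(\mathbf R^d)$, with domains $D(A_\varepsilon)\supset\mathcal S(\mathbf R^d)$, on which $A_\varepsilon=\mathrm{Op}^W_\varepsilon(a_\varepsilon)$, where the $a_\varepsilon$ are smooth and there are $K,m$ such that $|\partial^\alpha a_\varepsilon(z)|\le C_\alpha\varepsilon^{-K}(1+|z|)^m$ for all $\alpha$, $z$, $\varepsilon$.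 A family $u_\varepsilon\in L^2(\mathbf R^d)$ is *tempered* if $\|u_\varepsilon\|_{L^2}=O(\varepsilon^{-K})$ as $\varepsilon\to0$ for some $K$ (e.g. if it is bounded). It is *microlocalized in* $\Omega\subset\mathbf R^{2d}$ if for every $z\notin\Omega$ there is a smooth function $\chi$ on $\mathbf R^{2d}$, bounded with all its derivatives and with $\chi(z)=1$, such that $\|\mathrm{Op}^W_\varepsilon(\chi)u_\varepsilon\|_{L^2}=O(\varepsilon^\infty)$. A family of operators $R_\varepsilon$ is $O(\varepsilon^\infty)$ *microlocally on* $\Omega$ if $\|R_\varepsilon u_\varepsilon\|_{L^2}=O(\varepsilon^\infty)$ for every tempered family $u_\varepsilon\in D(R_\varepsilon)$ that is microlocalized in $\Omega$. **Proposition.** Let $\Omega\subset\mathbf R^{2d}$ and let $A_\varepsilon$, $\tilde A_\varepsilon$ be two families of pseudodifferential operators such that - $A_\varepsilon$ is hermitian in $L^2(\mathbf R^d)$ (equivalently, $iA_\varepsilon$ is skew-hermitian): $\langle A_\varepsilon u,v\rangle=\langle u,A_\varepsilon v\rangle$ for $u,v\in D(A_\varepsilon)$; - $A_\varepsilon-\tilde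 A_\varepsilon$, with domain $D(A_\varepsilon)\cap D(\tilde A_\varepsilon)$, is $O(\varepsilon^\infty)$ microlocally on $\Omega$. Let $\tilde\varphi_\varepsilon$ be a solution for $t\ge0$ of $i\partial_t\tilde\varphi+\tilde A_\varepsilon\tilde\varphi=0$ (differentiable in $t$ with values in $L^2(\mathbf R^d)$, and with values in $D(A_\varepsilon)\cap D(\tilde A_\varepsilon)$), with tempered initial data, and microlocalized in $\Omega$, in the sense that for every $N\in\mathbf N$ and every choice of times $t_\varepsilon\in[0,\varepsilon^{-N}]$ the family $\tilde\varphi_\varepsilon(t_\varepsilon)$ is microlocalized in $\Omega$. Let $\varphi_\varepsilon$ be the solution for $t\ge 0$ of $i\partial_t\varphi+A_\varepsilon\varphi=0$ (differentiable in $t$ with values in $L^2(\mathbf R^d)$, and with values in $D(A_\varepsilon)$) with the same initial data. Then, for all $N\in\mathbf N$, $$\sup_{0\le t\le\varepsilon^{-N}}\|\varphi_\varepsilon(t)-\tilde\varphi_\varepsilon(t)\|_{L^2(\mathbf R^d)}=O(\varepsilon^\infty).$$ -/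

import Mathlib

open MeasureTheory Set
open scoped ContDiff ENNReal SchwartzMap ComplexConjugate

/-- The configuration space `ℝ^d`, with its Euclidean norm. -/
abbrev ConfSpace (d : ℕ) : Type := EuclideanSpace ℝ (Fin d)

/-- Phase space `T*ℝ^d = ℝ^{2d}`, with points `(x, ξ)`. -/
abbrev PhaseSpace (d : ℕ) : Type := ConfSpace d × ConfSpace d

/-- The complex Hilbert space `L²(ℝ^d)`. -/
abbrev L2Space (d : ℕ) : Type := Lp ℂ 2 (volume : Measure (ConfSpace d))

/-- `g ε = O(ε^∞)`: for every `N` there are `ε₁ > 0` and `C` with `g ε ≤ C ε^N` on `]0, ε₁]`. -/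
def IsBigOInfty (g : ℝ → ℝ≥0∞) : Prop :=
  ∀ N : ℕ, ∃ ε₁ : ℝ, 0 < ε₁ ∧ ∃ C : ℝ, ∀ ε ∈ Ioc (0 : ℝ) ε₁, g ε ≤ ENNReal.ofReal (C * ε ^ N)

/-- An at most polynomially large family of `L²` functions: `‖u ε‖ = O(ε^{-K})` for some `K`.
Families that are bounded in `L²` are the case `K = 0`. -/
def IsTemperedFamily {d : ℕ} (u : ℝ → L2Space d) : Prop :=
  ∃ K : ℕ, ∃ ε₁ : ℝ, 0 < ε₁ ∧ ∃ C : ℝ, ∀ ε ∈ Ioc (0 : ℝ) ε₁, ‖u ε‖ ≤ C * ε ^ (-(K : ℤ))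

/-- Smooth functions on phase space that are bounded together with all their derivatives. -/
def IsBoundedSymbol {d : ℕ} (χ : PhaseSpace d → ℂ) : Prop :=
  ContDiff ℝ ∞ χ ∧ ∀ k : ℕ, ∃ C : ℝ, ∀ z, ‖iteratedFDeriv ℝ k χ z‖ ≤ C

/-- A semiclassical family of symbols `a ε`, `0 < ε ≤ ε₀`: each `a ε` is smooth, and all
derivatives of `a ε` are `O(ε^{-K} (1 + |z|)^m)` uniformly in `ε`, with `K` and `m` independent of
the order of differentiation. (Every order function is dominated by some `(1 + |z|)^m`.) -/
def IsSymbolFamily {d : ℕ} (ε₀ : ℝ) (a : ℝ → PhaseSpace d → ℂ) : Prop :=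
  (∀ ε ∈ Ioc (0 : ℝ) ε₀, ContDiff ℝ ∞ (a ε)) ∧
    ∃ K m : ℕ, ∀ k : ℕ, ∃ C : ℝ, ∀ ε ∈ Ioc (0 : ℝ) ε₀, ∀ z,
      ‖iteratedFDeriv ℝ k (a ε) z‖ ≤ C * ε ^ (-(K : ℤ)) * (1 + ‖z‖) ^ m

/-- The Weyl quantization `Op^W_ε(a)`, on Schwartz functions `f`:
`(2πε)^{-d} ∫∫ e^{i (x - y)·ξ / ε} a((x + y)/2, ξ) f(y) dy dξ`. The iterated integral (first in
`y`, then in `ξ`) converges absolutely at each stage for the symbols above. -/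
noncomputable def weylOp {d : ℕ} (ε : ℝ) (a : PhaseSpace d → ℂ) (f : ConfSpace d → ℂ)
    (x : ConfSpace d) : ℂ :=
  (((2 * Real.pi * ε) ^ d : ℝ) : ℂ)⁻¹ *
    ∫ ξ : ConfSpace d, ∫ y : ConfSpace d,
      Complex.exp (Complex.I * ((inner ℝ (x - y) ξ / ε : ℝ) : ℂ)) *
        a ((2⁻¹ : ℝ) • (x + y), ξ) * f y

/-- `Op^W_ε(a) u = v` for `u, v ∈ L²`, in the sense of tempered distributions: by duality with the
formal adjoint `Op^W_ε(conj a)` acting on Schwartz functions. -/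
def WeylMapsTo {d : ℕ} (ε : ℝ) (a : PhaseSpace d → ℂ) (u v : L2Space d) : Prop :=
  ∀ f : 𝓢(ConfSpace d, ℂ),
    ∫ x, conj (weylOp ε (fun z => conj (a z)) f x) * u x = ∫ x, conj (f x) * v x

/-- The family `u` is microlocalized in `Ω`: for every phase space point `z` outside `Ω` there is
a smooth `χ`, bounded with all its derivatives and equal to one at `z`, such that
`‖Op^W_ε(χ) u ε‖ = O(ε^∞)` in `L²`. -/
def MicrolocalizedIn {d : ℕ} (Ω : Set (PhaseSpace d)) (u : ℝ → L2Space d) : Prop :=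
  ∀ z ∉ Ω, ∃ χ : PhaseSpace d → ℂ, IsBoundedSymbol χ ∧ χ z = 1 ∧
    ∃ v : ℝ → L2Space d,
      (∃ ε₁ : ℝ, 0 < ε₁ ∧ ∀ ε ∈ Ioc (0 : ℝ) ε₁, WeylMapsTo ε χ (u ε) (v ε)) ∧
      IsBigOInfty (fun ε => ‖v ε‖ₑ)

/-- A family of (possibly unbounded) semiclassical pseudodifferential operators in `L²(ℝ^d)`: each
operator is defined at least on Schwartz functions, and acts on its whole domain as the Weyl
quantization of a symbol family. -/
def IsPseudodiffFamily {d : ℕ} (ε₀ : ℝ) (A : ℝ → L2Space d →ₗ.[ℂ] L2Space d) : Prop :=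
  ∃ a : ℝ → PhaseSpace d → ℂ, IsSymbolFamily ε₀ a ∧ ∀ ε ∈ Ioc (0 : ℝ) ε₀,
    (∀ f : 𝓢(ConfSpace d, ℂ), f.toLp 2 volume ∈ (A ε).domain) ∧
      ∀ u : (A ε).domain, WeylMapsTo ε (a ε) (u : L2Space d) (A ε u)

/-- `R ε = O(ε^∞)` microlocally on `Ω`: the family `R ε` sends every tempered family of functions
(in the domains of the `R ε`) that is microlocalized in `Ω` to a family that is `O(ε^∞)` in
`L²`. -/
def IsBigOInftyMicrolocallyOn {d : ℕ} (Ω : Set (PhaseSpace d))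
    (R : ℝ → L2Space d →ₗ.[ℂ] L2Space d) : Prop :=
  ∀ u : (ε : ℝ) → (R ε).domain,
    IsTemperedFamily (fun ε => (u ε : L2Space d)) →
    MicrolocalizedIn Ω (fun ε => (u ε : L2Space d)) →
      IsBigOInfty (fun ε => ‖R ε (u ε)‖ₑ)

/-- `φ` solves `i ∂_t φ + A φ = 0` for `t ≥ 0`, in `L²` (the derivative at `0` is one-sided). -/
def SolvesEvolution {d : ℕ} (A : L2Space d →ₗ.[ℂ] L2Space d) (φ : ℝ → L2Space d) : Prop :=
  ∀ t : ℝ, 0 ≤ t → ∃ (h : φ t ∈ A.domain) (φ' : L2Space d),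
    HasDerivWithinAt φ φ' (Ici 0) t ∧ Complex.I • φ' + A ⟨φ t, h⟩ = 0

/-! With `w = φ - φ'` one has `∂ₜ w = i (A w + (A - A') φ')`, and `⟨w, A w⟩` is real, so `‖w‖` grows
at rate at most `‖(A - A') φ'‖`. It remains to bound this residual by any power of `ε`, uniformly on
`[0, ε^{-N}]`.

Two gaps must be closed. The microlocal hypothesis speaks of one time per `ε`: choosing a time that
nearly maximizes the residual gives uniformity (`exists_forall_norm_lt_of_isBigOInfty`). It also
needs `φ'` tempered at later times, whereas `A'` is not assumed hermitian. A bootstrap supplies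
this: at times where `‖φ'(t)‖ ≤ ‖φ'(0)‖ + 1` the residual is small, and the energy estimate for `φ'`
itself (`SolvesEvolution.norm_le_of_sub_small`) then shows that this bound is never left. Hence the
barrier lemma only constrains contact times. -/

/-- A barrier lemma for the norm: if the norm of `u` can only grow slower than `η` at the times when
it equals `c + η t`, then it never exceeds `c + η t`. -/
theorem norm_le_add_mul_of_re_inner_lt {E : Type*} [NormedAddCommGroup E] [InnerProductSpace ℂ E]
    [NormedSpace ℝ E] [IsScalarTower ℝ ℂ E] {u u' : ℝ → E} {c η T : ℝ} (hc : 0 ≤ c) (hη : 0 ≤ η)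
    (hu : ∀ t, 0 ≤ t → HasDerivWithinAt u (u' t) (Ici 0) t) (h0 : ‖u 0‖ ≤ c)
    (hlt : ∀ t ∈ Icc 0 T, ‖u t‖ = c + η * t → (inner ℂ (u t) (u' t)).re < η * ‖u t‖) :
    ∀ t ∈ Icc 0 T, ‖u t‖ ≤ c + η * t := by
  -- The squared norm is used because the norm need not be differentiable where `u` vanishes.
  have hd : ∀ t, 0 ≤ t → HasDerivWithinAt (fun s => ‖u s‖ ^ 2)
      (2 * (inner ℂ (u t) (u' t)).re) (Ici 0) t := by
    intro t ht
    have h := (Complex.reCLM.hasFDerivAt.comp_hasDerivWithinAt t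
      ((hu t ht).inner ℂ (hu t ht)))
    refine (h.congr_deriv ?_).congr_of_mem ?_ ht
    · have := inner_re_symm (𝕜 := ℂ) (u t) (u' t)
      simp only [RCLike.re_eq_complex_re] at this
      simp [two_mul, this]
    · intro s _
      simpa using (inner_self_eq_norm_sq (𝕜 := ℂ) (u s)).symm
  have hsq : ∀ ⦃t⦄, t ∈ Icc 0 T → ‖u t‖ ^ 2 ≤ (c + η * t) ^ 2 := by
    refine image_le_of_deriv_right_lt_deriv_boundary (f' := fun t => 2 * (inner ℂ (u t) (u' t)).re)
      (B' := fun t => 2 * η * (c + η * t))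
      (fun t ht => ((hd t ht.1).continuousWithinAt).mono Icc_subset_Ici_self)
      (fun t ht => (hd t ht.1).mono (Ici_subset_Ici.2 ht.1)) ?_ ?_ ?_
    · simpa using pow_le_pow_left₀ (norm_nonneg _) h0 2
    · intro t
      have h := (((hasDerivAt_id t).const_mul η).const_add c).pow 2
      refine h.congr_deriv ?_
      simp; ring
    · intro t ht heq
      have hnn : 0 ≤ c + η * t := add_nonneg hc (mul_nonneg hη ht.1)
      have hn : ‖u t‖ = c + η * t := (pow_left_inj₀ (norm_nonneg _) hnn two_ne_zero).1 heq
      have := hlt t ⟨ht.1, ht.2.le⟩ hn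
      rw [hn] at this
      linarith
  intro t ht
  exact le_of_sq_le_sq (hsq ht) (add_nonneg hc (mul_nonneg hη ht.1))

/-- Since `⟨x, A x⟩` is real, `i A x` contributes nothing to the real part; Cauchy–Schwarz bounds
the rest. -/
theorem LinearPMap.IsFormalAdjoint.re_inner_I_smul_add_le {E : Type*} [NormedAddCommGroup E]
    [InnerProductSpace ℂ E] {A : E →ₗ.[ℂ] E} (hA : A.IsFormalAdjoint A) (x : A.domain) (r : E) :
    (inner ℂ (x : E) (Complex.I • (A x + r))).re ≤ ‖r‖ * ‖(x : E)‖ := by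
  have him : (inner ℂ (x : E) (A x)).im = 0 := by
    have h1 := congrArg Complex.im (inner_conj_symm (𝕜 := ℂ) (x : E) (A x))
    rw [hA x x] at h1
    simp only [Complex.conj_im] at h1
    linarith
  have h : (inner ℂ (x : E) (Complex.I • (A x + r))).re = (inner ℂ (x : E) (Complex.I • r)).re := by
    simp [him]
  rw [h]
  calc _ ≤ ‖inner ℂ (x : E) (Complex.I • r)‖ := Complex.re_le_norm _
    _ ≤ ‖(x : E)‖ * ‖Complex.I • r‖ := norm_inner_le_norm _ _
    _ = ‖r‖ * ‖(x : E)‖ := by rw [norm_smul]; simp [mul_comm]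

/-! ### From selections to uniform bounds -/

/-- On a nonempty set, a function either takes a value that is at least one or nearly attains its
supremum. -/
theorem Set.Nonempty.exists_one_le_or_forall_le_two_mul {α : Type*} {S : Set α} (hS : S.Nonempty)
    {g : α → ℝ} (hg : ∀ s, 0 ≤ g s) : ∃ τ ∈ S, 1 ≤ g τ ∨ ∀ s ∈ S, g s ≤ 2 * g τ := by
  -- The threshold covers unbounded `g`, which has no near-maximizer.
  by_cases h : ∃ τ ∈ S, 1 ≤ g τ
  · obtain ⟨τ, hτ, h1⟩ := h
    exact ⟨τ, hτ, Or.inl h1⟩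
  push Not at h
  have hb : BddAbove (g '' S) := ⟨1, by rintro _ ⟨s, hs, rfl⟩; exact (h s hs).le⟩
  have hle : ∀ s ∈ S, g s ≤ sSup (g '' S) := fun s hs => le_csSup hb (mem_image_of_mem g hs)
  obtain ⟨s₀, hs₀⟩ := hS
  rcases (hg s₀ |>.trans (hle s₀ hs₀)).eq_or_lt with h0 | h0
  · exact ⟨s₀, hs₀, Or.inr fun s hs => by linarith [hle s hs, hg s₀]⟩
  · obtain ⟨_, ⟨τ, hτ, rfl⟩, h1⟩ := exists_lt_of_lt_csSup ⟨_, mem_image_of_mem g hs₀⟩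
      (half_lt_self h0)
    exact ⟨τ, hτ, Or.inr fun s hs => by linarith [hle s hs]⟩

theorem IsBigOInfty.exists_norm_lt {E : Type*} [NormedAddCommGroup E] {v : ℝ → E}
    (hv : IsBigOInfty fun ε => ‖v ε‖ₑ) (N : ℕ) {c : ℝ} (hc : 0 < c) :
    ∃ ε₁ : ℝ, 0 < ε₁ ∧ ∀ ε ∈ Ioc (0 : ℝ) ε₁, ‖v ε‖ < c * ε ^ N := by
  -- The spare power of `ε` absorbs the constant `C`.
  obtain ⟨ε₁, h₁, C, hC⟩ := hv (N + 1)
  have hC' : 0 < 2 * (|C| + 1) := by positivity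
  refine ⟨min ε₁ (c / (2 * (|C| + 1))), lt_min h₁ (by positivity), fun ε hε => ?_⟩
  have hε0 : 0 < ε := hε.1
  have h := hC ε ⟨hε0, hε.2.trans (min_le_left _ _)⟩
  have hs : ε * (2 * (|C| + 1)) ≤ c := (le_div_iff₀ hC').1 (hε.2.trans (min_le_right _ _))
  have hpow : 0 < ε ^ N := pow_pos hε0 N
  have hle : ‖v ε‖ ≤ |C| * ε ^ (N + 1) := by
    have h' : ‖v ε‖ₑ ≤ ENNReal.ofReal (|C| * ε ^ (N + 1)) :=
      h.trans (ENNReal.ofReal_le_ofReal (by gcongr; exact le_abs_self C))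
    rw [← ofReal_norm] at h'
    exact (ENNReal.ofReal_le_ofReal_iff (by positivity)).1 h'
  calc ‖v ε‖ ≤ |C| * ε ^ (N + 1) := hle
    _ = (ε * |C|) * ε ^ N := by ring
    _ < c * ε ^ N := by
      gcongr
      nlinarith [abs_nonneg C]

/-- A family of vectors that is `O(ε^∞)` along every selection of parameters is uniformly
`O(ε^∞)`. -/
theorem exists_forall_norm_lt_of_isBigOInfty {α E : Type*} [NormedAddCommGroup E]
    {S : ℝ → Set α} {v : ℝ → α → E} (hS : ∀ ε, (S ε).Nonempty)
    (hv : ∀ τ : ℝ → α, (∀ ε, τ ε ∈ S ε) → IsBigOInfty fun ε => ‖v ε (τ ε)‖ₑ)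
    (N : ℕ) {c : ℝ} (hc : 0 < c) :
    ∃ ε₁ : ℝ, 0 < ε₁ ∧ ∀ ε ∈ Ioc (0 : ℝ) ε₁, ∀ s ∈ S ε, ‖v ε s‖ < c * ε ^ N := by
  choose τ hτ hmax using fun ε =>
    (hS ε).exists_one_le_or_forall_le_two_mul fun s => norm_nonneg (v ε s)
  -- Order zero rules out the alternative `1 ≤ g τ`; next, `c / 2` offsets the factor two of
  -- near-maximality.
  obtain ⟨δ₀, hδ₀, h₀⟩ := (hv τ hτ).exists_norm_lt 0 one_pos
  obtain ⟨δ₁, hδ₁, h₁⟩ := (hv τ hτ).exists_norm_lt N (half_pos hc)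
  refine ⟨min δ₀ δ₁, lt_min hδ₀ hδ₁, fun ε hε s hs => ?_⟩
  have h0 := h₀ ε ⟨hε.1, hε.2.trans (min_le_left _ _)⟩
  have h1 := h₁ ε ⟨hε.1, hε.2.trans (min_le_right _ _)⟩
  rcases hmax ε with h | h
  · simp at h0
    linarith
  · linarith [h s hs]

theorem IsTemperedFamily.of_norm_le {d : ℕ} {u v : ℝ → L2Space d} (hu : IsTemperedFamily u)
    {ε₀ : ℝ} (hε₀ : 0 < ε₀) (h : ∀ ε ∈ Ioc (0 : ℝ) ε₀, ‖v ε‖ ≤ ‖u ε‖ + 1) :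
    IsTemperedFamily v := by
  obtain ⟨K, ε₁, hε₁, C, hC⟩ := hu
  refine ⟨K, min 1 (min ε₀ ε₁), by positivity, C + 1, fun ε hε => ?_⟩
  have h1 : ε ≤ 1 := hε.2.trans (min_le_left _ _)
  have h2 : ε ≤ ε₀ := hε.2.trans ((min_le_right _ _).trans (min_le_left _ _))
  have h3 : ε ≤ ε₁ := hε.2.trans ((min_le_right _ _).trans (min_le_right _ _))
  have hone : 1 ≤ ε ^ (-(K : ℤ)) := by
    rw [zpow_neg, zpow_natCast]
    exact (one_le_inv₀ (pow_pos hε.1 K)).2 (pow_le_one₀ hε.1.le h1)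
  linarith [h ε ⟨hε.1, h2⟩, hC ε ⟨hε.1, h3⟩]

theorem MicrolocalizedIn.congr {d : ℕ} {Ω : Set (PhaseSpace d)} {u v : ℝ → L2Space d}
    (hu : MicrolocalizedIn Ω u) {ε₀ : ℝ} (hε₀ : 0 < ε₀) (h : ∀ ε ∈ Ioc (0 : ℝ) ε₀, v ε = u ε) :
    MicrolocalizedIn Ω v := by
  intro z hz
  obtain ⟨χ, hχ, hχz, w, ⟨ε₁, hε₁, hw⟩, hO⟩ := hu z hz
  refine ⟨χ, hχ, hχz, w, ⟨min ε₀ ε₁, lt_min hε₀ hε₁, fun ε hε => ?_⟩, hO⟩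
  rw [h ε ⟨hε.1, hε.2.trans (min_le_left _ _)⟩]
  exact hw ε ⟨hε.1, hε.2.trans (min_le_right _ _)⟩

/-! ### Energy estimates -/

theorem SolvesEvolution.mem_domain {d : ℕ} {A : L2Space d →ₗ.[ℂ] L2Space d} {φ : ℝ → L2Space d}
    (h : SolvesEvolution A φ) {t : ℝ} (ht : 0 ≤ t) : φ t ∈ A.domain :=
  (h t ht).1

theorem SolvesEvolution.hasDerivWithinAt {d : ℕ} {A : L2Space d →ₗ.[ℂ] L2Space d}
    {φ : ℝ → L2Space d} (h : SolvesEvolution A φ) {t : ℝ} (ht : 0 ≤ t) :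
    HasDerivWithinAt φ (Complex.I • A ⟨φ t, h.mem_domain ht⟩) (Ici 0) t := by
  obtain ⟨hm, φ', hd, he⟩ := h t ht
  convert hd using 1
  rw [eq_neg_of_add_eq_zero_right he, smul_neg, smul_smul, Complex.I_mul_I, neg_one_smul, neg_neg]

/-- If `A` is hermitian and `φ` solves the evolution equation of `A'`, then `φ` stays below a
barrier `c + η t` as long as `(A - A') φ` is smaller than `η` wherever `φ` meets the barrier. -/
theorem SolvesEvolution.norm_le_of_sub_small {d : ℕ} {A A' : L2Space d →ₗ.[ℂ] L2Space d}
    (hA : A.IsFormalAdjoint A) {φ : ℝ → L2Space d} (hφ : SolvesEvolution A' φ)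
    (hdom : ∀ t, 0 ≤ t → φ t ∈ A.domain) {c η T : ℝ} (hc : 0 < c) (hη : 0 ≤ η) (h0 : ‖φ 0‖ ≤ c)
    (hr : ∀ t ∈ Icc 0 T, ‖φ t‖ = c + η * t → ∀ h : φ t ∈ (A - A').domain,
      ‖(A - A') ⟨φ t, h⟩‖ < η) :
    ∀ t ∈ Icc 0 T, ‖φ t‖ ≤ c + η * t := by
  have hu : ∀ t, 0 ≤ t → HasDerivWithinAt φ (derivWithin φ (Ici 0) t) (Ici 0) t := fun t ht =>
    (hφ.hasDerivWithinAt ht).differentiableWithinAt.hasDerivWithinAt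
  refine norm_le_add_mul_of_re_inner_lt hc.le hη hu h0 fun t ht heq => ?_
  have hm : φ t ∈ (A - A').domain := ⟨hdom t ht.1, hφ.mem_domain ht.1⟩
  have hpos : 0 < ‖φ t‖ := by
    rw [heq]
    exact add_pos_of_pos_of_nonneg hc (mul_nonneg hη ht.1)
  rw [(hφ.hasDerivWithinAt ht.1).derivWithin (uniqueDiffOn_Ici 0 t ht.1)]
  have hre := hA.re_inner_I_smul_add_le ⟨φ t, hdom t ht.1⟩ (-(A - A') ⟨φ t, hm⟩)
  have hsplit : A ⟨φ t, hdom t ht.1⟩ + -(A - A') ⟨φ t, hm⟩ = A' ⟨φ t, hφ.mem_domain ht.1⟩ := by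
    rw [LinearPMap.sub_apply]
    simp
  rw [hsplit, norm_neg] at hre
  exact hre.trans_lt (mul_lt_mul_of_pos_right (hr t ht heq hm) hpos)

/-- Duhamel estimate: if `A` is hermitian and `(A - A') φ'` is smaller than `η` along a solution
`φ'` of the evolution equation of `A'`, then the solution `φ` for `A` with the same initial data
stays within `c + η t` of it. -/
theorem SolvesEvolution.norm_sub_le {d : ℕ} {A A' : L2Space d →ₗ.[ℂ] L2Space d}
    (hA : A.IsFormalAdjoint A) {φ φ' : ℝ → L2Space d} (hφ : SolvesEvolution A φ)
    (hφ' : SolvesEvolution A' φ') (hdom : ∀ t, 0 ≤ t → φ' t ∈ A.domain) (hinit : φ 0 = φ' 0)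
    {c η T : ℝ} (hc : 0 < c) (hη : 0 ≤ η)
    (hr : ∀ t ∈ Icc 0 T, ∀ h : φ' t ∈ (A - A').domain, ‖(A - A') ⟨φ' t, h⟩‖ < η) :
    ∀ t ∈ Icc 0 T, ‖φ t - φ' t‖ ≤ c + η * t := by
  have hd : ∀ t (ht : 0 ≤ t), HasDerivWithinAt (fun s => φ s - φ' s)
      (Complex.I • A ⟨φ t, hφ.mem_domain ht⟩ - Complex.I • A' ⟨φ' t, hφ'.mem_domain ht⟩)
      (Ici 0) t := fun t ht => (hφ.hasDerivWithinAt ht).sub (hφ'.hasDerivWithinAt ht)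
  have hu : ∀ t, 0 ≤ t → HasDerivWithinAt (fun s => φ s - φ' s)
      (derivWithin (fun s => φ s - φ' s) (Ici 0) t) (Ici 0) t := fun t ht =>
    (hd t ht).differentiableWithinAt.hasDerivWithinAt
  refine norm_le_add_mul_of_re_inner_lt hc.le hη hu (by simpa [hinit] using hc.le)
    fun t ht heq => ?_
  have hm : φ' t ∈ (A - A').domain := ⟨hdom t ht.1, hφ'.mem_domain ht.1⟩
  have hpos : 0 < ‖φ t - φ' t‖ := by
    rw [heq]
    exact add_pos_of_pos_of_nonneg hc (mul_nonneg hη ht.1)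
  rw [(hd t ht.1).derivWithin (uniqueDiffOn_Ici 0 t ht.1)]
  have hre := hA.re_inner_I_smul_add_le
    (⟨φ t, hφ.mem_domain ht.1⟩ - ⟨φ' t, hdom t ht.1⟩) ((A - A') ⟨φ' t, hm⟩)
  have hsplit : A (⟨φ t, hφ.mem_domain ht.1⟩ - ⟨φ' t, hdom t ht.1⟩) + (A - A') ⟨φ' t, hm⟩ =
      A ⟨φ t, hφ.mem_domain ht.1⟩ - A' ⟨φ' t, hφ'.mem_domain ht.1⟩ := by
    rw [LinearPMap.sub_apply, LinearPMap.map_sub]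
    simp
  rw [hsplit, smul_sub] at hre
  exact hre.trans_lt (mul_lt_mul_of_pos_right (hr t ht hm) hpos)

/-- If `R = O(ε^∞)` microlocally on `Ω`, then `R` is uniformly `O(ε^∞)` along curves all of whose
selections on `S ε` are tempered and microlocalized in `Ω`. -/
theorem IsBigOInftyMicrolocallyOn.exists_forall_norm_lt {d : ℕ} {Ω : Set (PhaseSpace d)}
    {R : ℝ → L2Space d →ₗ.[ℂ] L2Space d} (hR : IsBigOInftyMicrolocallyOn Ω R) {ε₀ : ℝ}
    (hε₀ : 0 < ε₀) {S : ℝ → Set ℝ} (hS : ∀ ε, (S ε).Nonempty) {φ : ℝ → ℝ → L2Space d}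
    (hdom : ∀ ε ∈ Ioc (0 : ℝ) ε₀, ∀ t ∈ S ε, φ ε t ∈ (R ε).domain)
    (htemp : ∀ τ : ℝ → ℝ, (∀ ε, τ ε ∈ S ε) → IsTemperedFamily fun ε => φ ε (τ ε))
    (hmicro : ∀ τ : ℝ → ℝ, (∀ ε, τ ε ∈ S ε) → MicrolocalizedIn Ω fun ε => φ ε (τ ε))
    (N : ℕ) {c : ℝ} (hc : 0 < c) :
    ∃ ε₁ : ℝ, 0 < ε₁ ∧ ∀ ε ∈ Ioc (0 : ℝ) ε₁, ∀ t ∈ S ε, ∀ h : φ ε t ∈ (R ε).domain,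
      ‖R ε ⟨φ ε t, h⟩‖ < c * ε ^ N := by
  classical
  -- A selection must lie in the domain for every real `ε`; the default `0` is reached on `S ε` only
  -- for `ε` outside `]0, ε₀]`.
  let u : (ε : ℝ) → ℝ → (R ε).domain := fun ε t =>
    if h : φ ε t ∈ (R ε).domain then ⟨φ ε t, h⟩ else 0
  have hu : ∀ ε t, ∀ h : φ ε t ∈ (R ε).domain, u ε t = ⟨φ ε t, h⟩ := fun ε t h => dif_pos h
  obtain ⟨ε₁, h₁, H⟩ := exists_forall_norm_lt_of_isBigOInfty (v := fun ε t => R ε (u ε t)) hS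
    (fun τ hτ => by
      have heq : ∀ ε ∈ Ioc (0 : ℝ) ε₀, (u ε (τ ε) : L2Space d) = φ ε (τ ε) := fun ε hε => by
        rw [hu ε _ (hdom ε hε _ (hτ ε))]
      refine hR (fun ε => u ε (τ ε)) ((htemp τ hτ).of_norm_le hε₀ fun ε hε => ?_)
        ((hmicro τ hτ).congr hε₀ heq)
      rw [heq ε hε]
      linarith) N hc
  refine ⟨ε₁, h₁, fun ε hε t ht h => ?_⟩
  rw [← hu ε t h]
  exact H ε hε t ht

theorem mainTheorem2 (d : ℕ) (Ω : Set (PhaseSpace d)) (ε₀ : ℝ) (hε₀ : 0 < ε₀)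
    (A A' : ℝ → L2Space d →ₗ.[ℂ] L2Space d)
    (hA : IsPseudodiffFamily ε₀ A) (hA' : IsPseudodiffFamily ε₀ A')
    (hherm : ∀ ε ∈ Set.Ioc (0 : ℝ) ε₀, (A ε).IsFormalAdjoint (A ε))
    (hdiff : IsBigOInftyMicrolocallyOn Ω (fun ε => A ε - A' ε))
    (φ φ' : ℝ → ℝ → L2Space d)
    (hφ' : ∀ ε ∈ Set.Ioc (0 : ℝ) ε₀, SolvesEvolution (A' ε) (φ' ε))
    (hdom : ∀ ε ∈ Set.Ioc (0 : ℝ) ε₀, ∀ t : ℝ, 0 ≤ t → φ' ε t ∈ (A ε).domain)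
    (hmicro : ∀ N : ℕ, ∀ τ : ℝ → ℝ,
      (∀ ε ∈ Set.Ioc (0 : ℝ) ε₀, τ ε ∈ Set.Icc 0 (ε ^ (-(N : ℤ)))) →
        MicrolocalizedIn Ω (fun ε => φ' ε (τ ε)))
    (hφ : ∀ ε ∈ Set.Ioc (0 : ℝ) ε₀, SolvesEvolution (A ε) (φ ε))
    (hinit : ∀ ε ∈ Set.Ioc (0 : ℝ) ε₀, φ ε 0 = φ' ε 0)
    (hdata : IsTemperedFamily (fun ε => φ' ε 0)) :
    ∀ N : ℕ, IsBigOInfty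
      (fun ε => ⨆ t ∈ Set.Icc (0 : ℝ) (ε ^ (-(N : ℤ))), ‖φ ε t - φ' ε t‖ₑ) := by
  intro N M
  -- The bootstrap set; time `0` keeps it nonempty for every real `ε`.
  let S : ℝ → Set ℝ := fun ε => {t | t = 0 ∨ (t ∈ Icc (0 : ℝ) (ε ^ (-(N : ℤ))) ∧
    ‖φ' ε t‖ ≤ ‖φ' ε 0‖ + 1)}
  have hIcc : ∀ ε ∈ Ioc (0 : ℝ) ε₀, ∀ t ∈ S ε, t ∈ Icc (0 : ℝ) (ε ^ (-(N : ℤ))) := by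
    rintro ε hε t (rfl | h)
    · exact ⟨le_rfl, (zpow_pos hε.1 _).le⟩
    · exact h.1
  have hnorm : ∀ ε, ∀ t ∈ S ε, ‖φ' ε t‖ ≤ ‖φ' ε 0‖ + 1 := by
    rintro ε t (rfl | h)
    · linarith
    · exact h.2
  have key : ∀ (n : ℕ) {c : ℝ}, 0 < c → ∃ ε₁ : ℝ, 0 < ε₁ ∧ ∀ ε ∈ Ioc (0 : ℝ) ε₁, ∀ t ∈ S ε,
      ∀ h : φ' ε t ∈ (A ε - A' ε).domain, ‖(A ε - A' ε) ⟨φ' ε t, h⟩‖ < c * ε ^ n := by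
    refine fun n c hc => hdiff.exists_forall_norm_lt hε₀ (fun ε => ⟨0, Or.inl rfl⟩) ?_ ?_ ?_ n hc
    · intro ε hε t ht
      have ht0 := (hIcc ε hε t ht).1
      exact ⟨hdom ε hε t ht0, (hφ' ε hε).mem_domain ht0⟩
    · exact fun τ hτ => hdata.of_norm_le hε₀ fun ε _ => hnorm ε _ (hτ ε)
    · exact fun τ hτ => hmicro N τ fun ε hε => hIcc ε hε _ (hτ ε)
  -- Rate `ε^N / 2` over time `ε^{-N}` adds at most `1/2`; rate `ε^(M + N)` adds at most `ε^M`.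
  obtain ⟨δ₁, hδ₁, h₁⟩ := key N (c := 1 / 2) (by norm_num)
  obtain ⟨δ₂, hδ₂, h₂⟩ := key (M + N) one_pos
  refine ⟨min ε₀ (min δ₁ δ₂), by positivity, 2, fun ε hε => ?_⟩
  have hε0 : 0 < ε := hε.1
  have hεmem : ε ∈ Ioc (0 : ℝ) ε₀ := ⟨hε0, hε.2.trans (min_le_left _ _)⟩
  have hε1 : ε ≤ δ₁ := hε.2.trans ((min_le_right _ _).trans (min_le_left _ _))
  have hε2 : ε ≤ δ₂ := hε.2.trans ((min_le_right _ _).trans (min_le_right _ _))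
  have hpow : ∀ t ∈ Icc (0 : ℝ) (ε ^ (-(N : ℤ))), ε ^ N * t ≤ 1 := by
    intro t ht
    calc ε ^ N * t ≤ ε ^ N * ε ^ (-(N : ℤ)) := by gcongr; exact ht.2
      _ = 1 := by rw [zpow_neg, zpow_natCast, mul_inv_cancel₀ (pow_pos hε0 N).ne']
  -- Closing the bootstrap: the barrier runs from `‖φ'(0)‖ + 1/2` to at most `‖φ'(0)‖ + 1`, so any
  -- contact time lies in `S ε`, where the residual is controlled.
  have hS : ∀ t ∈ Icc (0 : ℝ) (ε ^ (-(N : ℤ))), t ∈ S ε := by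
    have hb := (hφ' ε hεmem).norm_le_of_sub_small (hherm ε hεmem) (hdom ε hεmem)
      (c := ‖φ' ε 0‖ + 1 / 2) (η := 1 / 2 * ε ^ N) (T := ε ^ (-(N : ℤ))) (by positivity)
      (by positivity) (by linarith)
      fun t ht heq => h₁ ε ⟨hε0, hε1⟩ t (Or.inr ⟨ht, by linarith [hpow t ht]⟩)
    exact fun t ht => Or.inr ⟨ht, by linarith [hb t ht, hpow t ht]⟩
  -- The barrier must start positive; height `ε^M` plus growth at most `ε^M` gives the constant `2`.
  have hfin := (hφ ε hεmem).norm_sub_le (hherm ε hεmem) (hφ' ε hεmem) (hdom ε hεmem)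
    (hinit ε hεmem) (c := ε ^ M) (η := 1 * ε ^ (M + N)) (T := ε ^ (-(N : ℤ))) (by positivity)
    (by positivity) fun t ht => h₂ ε ⟨hε0, hε2⟩ t (hS t ht)
  refine iSup₂_le fun t ht => ?_
  rw [← ofReal_norm]
  refine ENNReal.ofReal_le_ofReal ((hfin t ht).trans ?_)
  have := mul_le_mul_of_nonneg_left (hpow t ht) (pow_pos hε0 M).le
  rw [pow_add]
  linarith
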